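/- Let $N\ge 1$ be an integer. Consider the problem of finding $$\hat J_N=\max\Big\{\sum_{j=1}^N\alpha_j\ :\ \alpha_1,\dots,\alpha_N\in\mathbb R,\ \alpha_1=1,\ \sum_{j=1}^N\alpha_j\sin jt\ge 0\ \text{ for all } t\in[0,\pi]\Big\}.$$ A polynomial $F(z)=\sum_{j=1}^N\alpha_jz^j$ whose coefficients satisfy these constraints and attain this maximum is called extremal. Then there is exactly one extremal polynomial. Moreover, let $I$ be the $N\times N$ unit matrix, and let $A=(a_{ij})$ and $B=(b_{ij})$ be the real symmetric $N\times N$ matrices with $a_{ij}=\tfrac12$ if $|i-j|=1$ and $a_{ij}=0$ otherwise, $b_{ij}=\tfrac12$ if $|i-j|=2$ and $b_{ij}=0$ otherwise. Then the polynomial $\lambda\mapsto\det\big(I+A-\lambda(I-B)\big)$ has a largest real root, that is, the pencil $I+A-\lambda(I-B)$ has a largest generalized eigenvalue, and this root is simple. -/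

import Mathlib

open Polynomial Matrix

noncomputable section

/-- The polynomials `z + α₂ z² + ⋯ + α_N z^N` with real coefficients whose sine polynomial
`∑ α_j sin (j t)` is nonnegative on `[0, π]`. -/
def admissible (N : ℕ) : Set ℝ[X] :=
  {p | p.natDegree ≤ N ∧ p.coeff 0 = 0 ∧ p.coeff 1 = 1 ∧
    ∀ t ∈ Set.Icc (0 : ℝ) Real.pi,
      0 ≤ ∑ j ∈ Finset.Icc 1 N, p.coeff j * Real.sin ((j : ℝ) * t)}

/-- The quantity `∑_{j = 1}^N α_j` to be maximized. -/
def coeffSum (N : ℕ) (p : ℝ[X]) : ℝ :=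
  ∑ j ∈ Finset.Icc 1 N, p.coeff j

/-- `p` is an extremal polynomial: it is admissible and attains the maximum of the coefficient sum
over all admissible polynomials. -/
def IsExtremal (N : ℕ) (p : ℝ[X]) : Prop :=
  p ∈ admissible N ∧ IsMaxOn (coeffSum N) (admissible N) p

/-- The symmetric `N × N` matrix with entries `1/2` on the first sub- and superdiagonal. -/
def matA (N : ℕ) : Matrix (Fin N) (Fin N) ℝ :=
  Matrix.of fun i j => if (i : ℕ) + 1 = j ∨ (j : ℕ) + 1 = i then 1 / 2 else 0

/-- The symmetric `N × N` matrix with entries `1/2` on the second sub- and superdiagonal. -/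
def matB (N : ℕ) : Matrix (Fin N) (Fin N) ℝ :=
  Matrix.of fun i j => if (i : ℕ) + 2 = j ∨ (j : ℕ) + 2 = i then 1 / 2 else 0

/-- The characteristic polynomial `det (I + A - λ (I - B))` of the pencil, in the variable `λ`.
Its roots are the generalized eigenvalues of the pencil. -/
def pencilDet (N : ℕ) : ℝ[X] :=
  ((1 + matA N).map C - (X : ℝ[X]) • (1 - matB N).map C).det

end

/-! Dividing an admissible sine polynomial by `sin t` leaves a polynomial in `cos t` of degree less
than `N`, nonnegative on `[-1, 1]`. By Fejér–Riesz it equals `|∑ d_k exp (i k t)|²` for some real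
vector `d` of length `N` (`exists_eq_fejerPoly`). In terms of `d`, the constraint `α₁ = 1` reads
`dᵀ(I - B)d = 1` and the objective is `dᵀ(I + A)d`. Since `I - B` is positive definite, the problem
is to maximize a Rayleigh quotient: the maximum is the largest generalized eigenvalue `l`, attained
exactly at the normalized kernel vectors of `S = I + A - l(I - B)`.

Uniqueness and simplicity both come from a Perron–Frobenius argument (`eq_zero_of_mulVec_eq_zero`).
`S` is negative semidefinite with nonnegative off-diagonal entries and positive ones next to the
diagonal, so a kernel vector is determined by its first entry and the kernel is a line. Hence the
extremal `d` is unique up to sign, and the sign disappears in `fejerPoly`, which is quadratic in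
`d`. For a symmetric-definite pencil algebraic and geometric multiplicities agree, so `l` is a
simple root. -/

/-! ### Symmetric-definite pencils and their largest eigenvalue -/

/-- A positive definite real matrix and a symmetric one are simultaneously diagonalizable by
congruence. -/
lemma exists_simultaneous_diagonalization {n : Type*} [Fintype n] [DecidableEq n]
    {M K : Matrix n n ℝ} (hM : M.IsHermitian) (hK : K.PosDef) :
    ∃ (T : Matrix n n ℝ) (μ : n → ℝ), IsUnit T ∧ Tᵀ * K * T = 1 ∧ Tᵀ * M * T = diagonal μ := by
  have hK1 := hK.isHermitian
  set U : Matrix n n ℝ := hK1.eigenvectorUnitary.1 with hU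
  have hUK : Uᵀ * K * U = diagonal hK1.eigenvalues := by
    have := hK1.conjStarAlgAut_star_eigenvectorUnitary
    rw [Unitary.conjStarAlgAut_star_apply] at this
    simpa [star_eq_conjTranspose] using this
  set s : n → ℝ := fun i => (√(hK1.eigenvalues i))⁻¹ with hs
  set R := U * diagonal s with hR
  have hRK : Rᵀ * K * R = 1 := by
    have : Rᵀ * K * R = diagonal s * (Uᵀ * K * U) * diagonal s := by
      simp [hR, transpose_mul, Matrix.mul_assoc]
    rw [this, hUK, diagonal_mul_diagonal, diagonal_mul_diagonal, ← diagonal_one]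
    congr 1
    funext i
    have h := hK.eigenvalues_pos i
    have h2 := Real.mul_self_sqrt h.le
    have h3 := (Real.sqrt_pos.2 h).ne'
    simp only [hs]
    field_simp
    rw [sq, h2]
  have hRM : (Rᵀ * M * R).IsHermitian := by
    have := isHermitian_conjTranspose_mul_mul R hM
    simpa using this
  set V : Matrix n n ℝ := hRM.eigenvectorUnitary.1 with hV
  have hVV : Vᵀ * V = 1 := by
    have := Unitary.coe_star_mul_self hRM.eigenvectorUnitary
    simpa [star_eq_conjTranspose] using this
  have hVM : Vᵀ * (Rᵀ * M * R) * V = diagonal hRM.eigenvalues := by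
    have := hRM.conjStarAlgAut_star_eigenvectorUnitary
    rw [Unitary.conjStarAlgAut_star_apply] at this
    simpa [star_eq_conjTranspose] using this
  have h1 : (R * V)ᵀ * K * (R * V) = 1 := by
    have : (R * V)ᵀ * K * (R * V) = Vᵀ * (Rᵀ * K * R) * V := by
      simp [transpose_mul, Matrix.mul_assoc]
    rw [this, hRK, Matrix.mul_one, hVV]
  refine ⟨R * V, hRM.eigenvalues, ?_, h1, ?_⟩
  · exact IsUnit.of_mul_eq_one_right _ h1
  · rw [← hVM]
    simp [transpose_mul, Matrix.mul_assoc]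

/-- The determinant of a symmetric-definite pencil, after simultaneous diagonalization. -/
lemma det_pencil_mul_eq_prod {n : Type*} [Fintype n] [DecidableEq n]
    {M K T : Matrix n n ℝ} {μ : n → ℝ} (hK : Tᵀ * K * T = 1) (hM : Tᵀ * M * T = diagonal μ) :
    C (T.det ^ 2) * (M.map C - (X : ℝ[X]) • K.map C).det = ∏ i, (C (μ i) - X) := by
  have h : (T.map C)ᵀ * (M.map C - (X : ℝ[X]) • K.map C) * T.map C =
      diagonal fun i => C (μ i) - X := by
    have e1 : (T.map C)ᵀ * M.map C * T.map C = (diagonal μ).map (C : ℝ → ℝ[X]) := by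
      rw [← hM, Matrix.map_mul, Matrix.map_mul, transpose_map]
    have e2 : (T.map C)ᵀ * K.map C * T.map C = (1 : Matrix n n ℝ[X]) := by
      rw [← transpose_map, ← Matrix.map_mul, ← Matrix.map_mul, hK]
      simp
    rw [Matrix.mul_sub, Matrix.sub_mul, e1, Matrix.mul_smul, Matrix.smul_mul, e2]
    rw [diagonal_map (by simp), ← diagonal_one, ← diagonal_smul, diagonal_sub]
    simp
  have := congrArg det h
  rw [det_mul, det_mul, det_transpose, det_diagonal] at this
  have hd : (T.map (C : ℝ → ℝ[X])).det = C T.det := (RingHom.map_det C T).symm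
  rw [hd] at this
  rw [← this, C_pow]
  ring

/-- If the quadratic form of `S` is nonpositive and vanishes at `v`, then `S v = 0`. -/
lemma mulVec_eq_zero_of_nonpos {n : Type*} [Fintype n]
    {S : Matrix n n ℝ} (hS : S.IsHermitian) (hn : ∀ v, v ⬝ᵥ S *ᵥ v ≤ 0) {v : n → ℝ}
    (hv : v ⬝ᵥ S *ᵥ v = 0) : S *ᵥ v = 0 := by
  have hp : (-S).PosSemidef := by
    refine PosSemidef.of_dotProduct_mulVec_nonneg hS.neg fun x => ?_
    have := hn x
    simp only [star_trivial, neg_mulVec, dotProduct_neg]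
    linarith
  have := (hp.dotProduct_mulVec_zero_iff v).1 (by simp [neg_mulVec, hv])
  simpa [neg_mulVec] using this

/-- A kernel vector of a negative semidefinite tridiagonally connected matrix with nonnegative
off-diagonal entries vanishes as soon as its first entry does. -/
lemma eq_zero_of_mulVec_eq_zero {N : ℕ} {S : Matrix (Fin N) (Fin N) ℝ} (hS : S.IsHermitian)
    (hn : ∀ v, v ⬝ᵥ S *ᵥ v ≤ 0) (hoff : ∀ i j, i ≠ j → 0 ≤ S i j)
    (hadj : ∀ i j : Fin N, (i : ℕ) + 1 = j → 0 < S i j) {v : Fin N → ℝ} (hv : S *ᵥ v = 0)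
    (h0 : ∀ i : Fin N, (i : ℕ) = 0 → v i = 0) : v = 0 := by
  -- Passing to absolute values cannot decrease the form, as the off-diagonal entries are
  -- nonnegative; so `|v|` is a kernel vector too.
  set u : Fin N → ℝ := fun i => |v i| with hu
  have hle : v ⬝ᵥ S *ᵥ v ≤ u ⬝ᵥ S *ᵥ u := by
    simp only [dotProduct, mulVec, Finset.mul_sum]
    refine Finset.sum_le_sum fun i _ => Finset.sum_le_sum fun j _ => ?_
    by_cases hij : i = j
    · subst hij
      have := abs_mul_abs_self (v i)
      simp only [hu]
      exact le_of_eq (by linear_combination -(S i i) * this)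
    · have h1 := hoff i j hij
      have h2 : v i * v j ≤ |v i| * |v j| := by
        rw [← abs_mul]
        exact le_abs_self _
      simp only [hu]
      nlinarith
  have hSu : S *ᵥ u = 0 := by
    apply mulVec_eq_zero_of_nonpos hS hn
    apply le_antisymm (hn u)
    rw [hv] at hle
    simpa using hle
  have key : ∀ k : ℕ, ∀ hk : k < N, u ⟨k, hk⟩ = 0 := by
    intro k
    induction k with
    | zero => intro hk; simp [hu, h0]
    | succ k ih =>
      intro hk
      have hi := ih (by omega)
      have hrow := congrFun hSu ⟨k, by omega⟩
      simp only [mulVec, dotProduct, Pi.zero_apply] at hrow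
      -- With `u k = 0` the diagonal term drops out, so row `k` is a vanishing sum of nonnegative
      -- terms, and the positive entry beside the diagonal forces `u (k + 1) = 0`.
      rw [Finset.sum_eq_zero_iff_of_nonneg] at hrow
      · have := hrow ⟨k + 1, hk⟩ (Finset.mem_univ _)
        exact (mul_eq_zero.1 this).resolve_left (hadj ⟨k, by omega⟩ ⟨k + 1, hk⟩ rfl).ne'
      · intro j _
        by_cases hj : (⟨k, by omega⟩ : Fin N) = j
        · rw [← hj, hi, mul_zero]
        · exact mul_nonneg (hoff _ _ hj) (abs_nonneg _)
  funext i
  simpa [hu] using key i i.2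

/-- The largest generalized eigenvalue of a symmetric-definite pencil: it is the maximum of the
Rayleigh quotient, is attained, and is a simple root if a kernel vector is determined by one of
its entries. -/
lemma exists_isGreatest_pencil {n : Type*} [Fintype n] [DecidableEq n] [Nonempty n]
    {M K : Matrix n n ℝ} (hM : M.IsHermitian) (hK : K.PosDef) :
    ∃ l : ℝ, (∀ v, v ⬝ᵥ (M - l • K) *ᵥ v ≤ 0) ∧ (∃ v, v ≠ 0 ∧ (M - l • K) *ᵥ v = 0) ∧
      IsGreatest {x : ℝ | ((M.map C - (X : ℝ[X]) • K.map C).det).IsRoot x} l ∧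
      ((∃ k, ∀ v, (M - l • K) *ᵥ v = 0 → v k = 0 → v = 0) →
        ((M.map C - (X : ℝ[X]) • K.map C).det).rootMultiplicity l = 1) := by
  obtain ⟨T, μ, hT, hTK, hTM⟩ := exists_simultaneous_diagonalization hM hK
  have hdet := det_pencil_mul_eq_prod hTK hTM
  have hT0 : T.det ≠ 0 := ((isUnit_iff_isUnit_det T).1 hT).ne_zero
  have hTS : ∀ x : ℝ, Tᵀ * (M - x • K) * T = diagonal fun i => μ i - x := by
    intro x
    rw [Matrix.mul_sub, Matrix.sub_mul, hTM, Matrix.mul_smul, Matrix.smul_mul, hTK,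
      ← diagonal_one, ← diagonal_smul, diagonal_sub]
    simp
  obtain ⟨i₀, -, hi₀⟩ := Finset.exists_max_image Finset.univ μ Finset.univ_nonempty
  have hTker : ∀ x w, (diagonal fun i => μ i - x) *ᵥ w = 0 → (M - x • K) *ᵥ (T *ᵥ w) = 0 := by
    intro x w hw
    rw [← hTS, ← mulVec_mulVec, ← mulVec_mulVec] at hw
    have hTt : IsUnit Tᵀ := (isUnit_transpose T).2 hT
    exact (mulVec_injective_iff_isUnit.2 hTt) (by rw [hw, mulVec_zero])
  have hTinj := mulVec_injective_iff_isUnit.2 hT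
  have hTsurj := mulVec_surjective_iff_isUnit.2 hT
  set p := (M.map C - (X : ℝ[X]) • K.map C).det with hp
  have hroot : ∀ x, p.IsRoot x ↔ ∃ i, μ i = x := by
    intro x
    have := congrArg (eval x) hdet
    rw [eval_mul, eval_C, eval_prod] at this
    rw [IsRoot.def]
    constructor
    · intro h
      rw [h, mul_zero, eq_comm, Finset.prod_eq_zero_iff] at this
      obtain ⟨i, -, hi⟩ := this
      exact ⟨i, by simpa [sub_eq_zero] using hi⟩
    · rintro ⟨i, hi⟩
      rw [Finset.prod_eq_zero (Finset.mem_univ i) (by simp [hi])] at this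
      exact (mul_eq_zero.1 this).resolve_left (pow_ne_zero _ hT0)
  refine ⟨μ i₀, ?_, ⟨T *ᵥ Pi.single i₀ 1, ?_, ?_⟩, ⟨(hroot _).2 ⟨i₀, rfl⟩, ?_⟩, ?_⟩
  · intro v
    obtain ⟨w, rfl⟩ := hTsurj v
    have : (T *ᵥ w) ⬝ᵥ (M - μ i₀ • K) *ᵥ (T *ᵥ w) =
        w ⬝ᵥ (Tᵀ * (M - μ i₀ • K) * T) *ᵥ w := by
      rw [← mulVec_mulVec, ← mulVec_mulVec, dotProduct_mulVec w Tᵀ, vecMul_transpose]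
    rw [this, hTS]
    simp only [dotProduct, mulVec_diagonal]
    refine Finset.sum_nonpos fun i hi => ?_
    nlinarith [hi₀ i hi, sq_nonneg (w i)]
  · intro h
    have := hTinj (h.trans (mulVec_zero T).symm)
    simpa using congrFun this i₀
  · apply hTker
    funext i
    rw [mulVec_diagonal]
    by_cases h : i = i₀
    · simp [h]
    · simp [h]
  · intro x hx
    obtain ⟨i, rfl⟩ := (hroot x).1 hx
    exact hi₀ i (Finset.mem_univ i)
  · rintro ⟨k, hk⟩
    have hsimple : ∀ i, i ≠ i₀ → μ i ≠ μ i₀ := by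
      -- A repeated top eigenvalue gives two independent kernel vectors, columns `i` and `i₀` of
      -- `T`; `w` combines them so that entry `k` cancels.
      intro i hi hμ
      set w : n → ℝ := Pi.single i (T k i₀) - Pi.single i₀ (T k i) with hw
      have hwker : (M - μ i₀ • K) *ᵥ (T *ᵥ w) = 0 := by
        apply hTker
        funext j
        rw [mulVec_diagonal]
        by_cases h : j = i₀
        · simp [h]
        · by_cases h' : j = i
          · simp [h', hμ]
          · simp [hw, h, h']
      have hwk : (T *ᵥ w) k = 0 := by
        simp [hw, mulVec_sub, mulVec_single]
        ring
      have hw0 : w = 0 := hTinj ((hk _ hwker hwk).trans (mulVec_zero T).symm)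
      have h1 : T k i₀ = 0 := by simpa [hw, hi] using congrFun hw0 i
      have h2 : T *ᵥ Pi.single i₀ 1 = 0 := by
        apply hk
        · apply hTker
          funext j
          rw [mulVec_diagonal]
          by_cases h : j = i₀
          · simp [h]
          · simp [h]
        · simpa using h1
      have := hTinj (h2.trans (mulVec_zero T).symm)
      simpa using congrFun this i₀
    have hp0 : p ≠ 0 := by
      intro h
      rw [h, mul_zero] at hdet
      obtain ⟨i, -, hi⟩ := Finset.prod_eq_zero_iff.1 hdet.symm
      have := congrArg (eval (μ i + 1)) hi
      simp at this
    have hge : 1 ≤ p.rootMultiplicity (μ i₀) :=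
      (rootMultiplicity_pos hp0).2 ((hroot _).2 ⟨i₀, rfl⟩)
    refine le_antisymm ?_ hge
    rw [rootMultiplicity_le_iff hp0]
    -- If the square of `X - μ i₀` divided `p`, cancelling one factor would leave a product over `i
    -- ≠ i₀` that vanishes at `μ i₀`.
    rintro ⟨q, hq⟩
    rw [hq, ← Finset.mul_prod_erase _ _ (Finset.mem_univ i₀)] at hdet
    have h2 : (X - C (μ i₀)) * ((X - C (μ i₀)) * (C (T.det ^ 2) * q)) =
        (X - C (μ i₀)) * (-∏ i ∈ Finset.univ.erase i₀, (C (μ i) - X)) := by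
      linear_combination hdet
    have h3 := congrArg (eval (μ i₀)) (mul_left_cancel₀ (X_sub_C_ne_zero _) h2)
    simp only [eval_mul, eval_sub, eval_X, eval_C, sub_self, zero_mul, eval_neg, eval_prod] at h3
    have h4 := neg_eq_zero.1 h3.symm
    obtain ⟨i, hi, h⟩ := Finset.prod_eq_zero_iff.1 h4
    exact hsimple i (Finset.ne_of_mem_erase hi) (sub_eq_zero.1 h)

/-! ### The matrices of the problem -/

lemma isHermitian_matA (N : ℕ) : (matA N).IsHermitian := by
  ext i j
  simp [matA, conjTranspose_apply, or_comm]

lemma isHermitian_matB (N : ℕ) : (matB N).IsHermitian := by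
  ext i j
  simp [matB, conjTranspose_apply, or_comm]

/-- The quadratic form of `1 - B`, doubled, as a sum of squares of second differences. -/
lemma sum_sq_sub_mul_shift_two (f : ℕ → ℝ) (N : ℕ) (h0 : f N = 0) (h1 : f (N + 1) = 0) :
    2 * ∑ i ∈ Finset.range N, (f i ^ 2 - f i * f (i + 2)) =
      f 0 ^ 2 + f 1 ^ 2 + ∑ i ∈ Finset.range N, (f i - f (i + 2)) ^ 2 := by
  have key : ∀ n : ℕ, 2 * ∑ i ∈ Finset.range n, (f i ^ 2 - f i * f (i + 2)) =
      f 0 ^ 2 + f 1 ^ 2 - f n ^ 2 - f (n + 1) ^ 2 +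
        ∑ i ∈ Finset.range n, (f i - f (i + 2)) ^ 2 := by
    intro n
    induction n with
    | zero => simp
    | succ n ih =>
      rw [Finset.sum_range_succ, Finset.sum_range_succ, mul_add, ih]
      ring
  rw [key, h0, h1]
  ring

/-- Extension of a vector by zero. -/
def extendZero {N : ℕ} (v : Fin N → ℝ) (n : ℕ) : ℝ := if h : n < N then v ⟨n, h⟩ else 0

@[simp] lemma extendZero_val {N : ℕ} (v : Fin N → ℝ) (i : Fin N) :
    extendZero v i = v i := by simp [extendZero]

lemma extendZero_of_le {N : ℕ} (v : Fin N → ℝ) {n : ℕ} (h : N ≤ n) : extendZero v n = 0 := by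
  simp [extendZero, h]

lemma dotProduct_one_sub_matB {N : ℕ} (v : Fin N → ℝ) :
    v ⬝ᵥ (1 - matB N) *ᵥ v =
      ∑ i ∈ Finset.range N, (extendZero v i ^ 2 - extendZero v i * extendZero v (i + 2)) := by
  have hrow : ∀ i : Fin N, ∑ j : Fin N, (if (i : ℕ) + 2 = j then v i * v j else 0) =
      extendZero v i * extendZero v (i + 2) := by
    intro i
    by_cases h : (i : ℕ) + 2 < N
    · rw [Finset.sum_eq_single ⟨i + 2, h⟩]
      · simp [extendZero, h]
      · intro j _ hj
        rw [if_neg]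
        intro h'
        exact hj (Fin.ext h'.symm)
      · simp
    · rw [extendZero_of_le v (not_lt.1 h), mul_zero]
      refine Finset.sum_eq_zero fun j _ => ?_
      rw [if_neg]
      omega
  have hB : v ⬝ᵥ matB N *ᵥ v = ∑ i : Fin N, extendZero v i * extendZero v (i + 2) := by
    have h1 : v ⬝ᵥ matB N *ᵥ v =
        (∑ i : Fin N, ∑ j : Fin N, (if (i : ℕ) + 2 = j then v i * v j else 0)) / 2 +
        (∑ i : Fin N, ∑ j : Fin N, (if (j : ℕ) + 2 = i then v j * v i else 0)) / 2 := by
      simp only [dotProduct, mulVec, Finset.mul_sum, Finset.sum_div, ← Finset.sum_add_distrib]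
      refine Finset.sum_congr rfl fun i _ => Finset.sum_congr rfl fun j _ => ?_
      simp only [matB, of_apply]
      split_ifs <;> first | omega | ring
    rw [h1, Finset.sum_comm (γ := Fin N) (f := fun i j : Fin N =>
      if (j : ℕ) + 2 = i then v j * v i else 0), Finset.sum_congr rfl fun i _ => hrow i]
    ring
  rw [sub_mulVec, one_mulVec, dotProduct_sub, hB, Finset.sum_sub_distrib,
    Finset.sum_range, Finset.sum_range]
  simp [dotProduct, sq]

/-- In the sum-of-squares form, a nonpositive value forces the first two entries and all differences
at distance two to vanish, hence the whole vector. -/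
lemma posDef_one_sub_matB (N : ℕ) : (1 - matB N).PosDef := by
  refine PosDef.of_dotProduct_mulVec_pos (isHermitian_one.sub (isHermitian_matB N)) fun v hv => ?_
  rw [star_trivial, dotProduct_one_sub_matB]
  have h := sum_sq_sub_mul_shift_two (extendZero v) N (extendZero_of_le v le_rfl)
    (extendZero_of_le v (Nat.le_succ N))
  have hs : 0 ≤ ∑ i ∈ Finset.range N, (extendZero v i - extendZero v (i + 2)) ^ 2 :=
    Finset.sum_nonneg fun i _ => sq_nonneg _
  by_contra hneg
  have h0 : extendZero v 0 ^ 2 = 0 := by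
    nlinarith [sq_nonneg (extendZero v 0), sq_nonneg (extendZero v 1)]
  have h1 : extendZero v 1 ^ 2 = 0 := by
    nlinarith [sq_nonneg (extendZero v 0), sq_nonneg (extendZero v 1)]
  have h2 : ∑ i ∈ Finset.range N, (extendZero v i - extendZero v (i + 2)) ^ 2 = 0 := by
    nlinarith
  rw [Finset.sum_eq_zero_iff_of_nonneg fun i _ => sq_nonneg _] at h2
  have key : ∀ n, extendZero v n = 0 ∧ extendZero v (n + 1) = 0 := by
    intro n
    induction n with
    | zero => exact ⟨by simpa using h0, by simpa using h1⟩
    | succ n ih =>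
      refine ⟨ih.2, ?_⟩
      by_cases hn : n < N
      · have := h2 n (Finset.mem_range.2 hn)
        rw [ih.1] at this
        simpa using this
      · exact extendZero_of_le v (by omega)
  exact hv (funext fun i => by rw [← extendZero_val v i, (key i).1, Pi.zero_apply])

/-- A kernel vector of the pencil at its largest generalized eigenvalue is determined by its
first entry. -/
lemma pencil_kernel_eq_zero {N : ℕ} (hN : 1 ≤ N) {l : ℝ}
    (hl : ∀ v, v ⬝ᵥ (1 + matA N - l • (1 - matB N)) *ᵥ v ≤ 0) {v : Fin N → ℝ}
    (hv : (1 + matA N - l • (1 - matB N)) *ᵥ v = 0) (h0 : v ⟨0, hN⟩ = 0) : v = 0 := by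
  -- Testing the form on the first basis vector bounds `l` below; the entries `l / 2` of `l • B` are
  -- then nonnegative.
  have hl1 : 1 ≤ l := by
    have := hl (Pi.single ⟨0, hN⟩ 1)
    simp [matA, matB] at this
    exact this
  refine eq_zero_of_mulVec_eq_zero ?_ hl ?_ ?_ hv ?_
  · have hAH := isHermitian_one.add (isHermitian_matA N)
    have hBH := isHermitian_one.sub (isHermitian_matB N)
    exact hAH.sub (by simpa [IsHermitian] using congrArg (l • ·) hBH.eq)
  · intro i j hij
    simp only [Matrix.sub_apply, Matrix.add_apply, Matrix.smul_apply, one_apply_ne hij, matA, matB, of_apply,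
      smul_eq_mul]
    split_ifs <;> linarith
  · intro i j hij
    have hne : i ≠ j := by
      rintro rfl
      omega
    simp only [Matrix.sub_apply, Matrix.add_apply, Matrix.smul_apply, one_apply_ne hne, matA, matB, of_apply,
      smul_eq_mul]
    rw [if_pos (Or.inl hij), if_neg (by omega)]
    norm_num
  · intro i hi
    rw [← h0]
    congr 1
    exact Fin.ext hi

/-! ### Fejér–Riesz factorization -/

/-- The complex form of the half-step in Fejér–Riesz factorization: on the unit circle
`cos t - w` has the modulus of a quadratic with real coefficients. -/
lemma normSq_cos_sub_eq (w : ℂ) : ∃ E : ℝ[X], E.natDegree ≤ 2 ∧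
    ∀ t : ℝ, Complex.normSq ((Real.cos t : ℂ) - w) =
      Complex.normSq (aeval (Complex.exp (t * Complex.I)) E) := by
  -- Joukowski substitution `w = (u + u⁻¹) / 2`. For `|z| = 1` it gives `2 z u (cos t - w) = (z -
  -- u)(z u - 1)` and `|z u - 1| = |z - conj u|`, so the conjugate pair `u`, `conj u` yields real
  -- coefficients.
  obtain ⟨u, hu⟩ : ∃ u : ℂ, u ^ 2 - 2 * w * u + 1 = 0 := by
    obtain ⟨s, hs⟩ := IsAlgClosed.exists_pow_nat_eq (w ^ 2 - 1) (n := 2) (by norm_num)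
    exact ⟨w + s, by linear_combination hs⟩
  have hu0 : u ≠ 0 := by
    rintro rfl
    simp at hu
  refine ⟨C (1 / (2 * ‖u‖)) * (X ^ 2 - C (2 * u.re) * X + C (‖u‖ ^ 2)), ?_, fun t => ?_⟩
  · compute_degree
  set z := Complex.exp (t * Complex.I) with hz
  have hz1 : z * (starRingEnd ℂ) z = 1 := by
    rw [Complex.mul_conj, Complex.normSq_eq_norm_sq, hz, Complex.norm_exp_ofReal_mul_I]
    simp
  have hzn : Complex.normSq z = 1 := by
    rw [Complex.normSq_eq_norm_sq, hz, Complex.norm_exp_ofReal_mul_I]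
    simp
  have hcos : (Real.cos t : ℂ) = (z + (starRingEnd ℂ) z) / 2 := by
    rw [Complex.ofReal_cos, Complex.cos, hz, ← Complex.exp_conj]
    simp
  have hun : Complex.normSq u ≠ 0 := by simpa using hu0
  have hE : aeval z (C (1 / (2 * ‖u‖)) * (X ^ 2 - C (2 * u.re) * X + C (‖u‖ ^ 2))) =
      ((1 / (2 * ‖u‖) : ℝ) : ℂ) * ((z - u) * (z - (starRingEnd ℂ) u)) := by
    have h1 : ((‖u‖ ^ 2 : ℝ) : ℂ) = u * (starRingEnd ℂ) u := by
      rw [Complex.mul_conj, Complex.normSq_eq_norm_sq]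
    have h2 : ((2 * u.re : ℝ) : ℂ) = u + (starRingEnd ℂ) u := by
      rw [Complex.add_conj]
    rw [map_mul, map_add, map_sub, map_mul, map_pow, aeval_X, aeval_C, aeval_C, aeval_C,
      Complex.coe_algebraMap, h1, h2]
    ring
  rw [hE]
  have hw : w = (u + u⁻¹) / 2 := by
    field_simp
    linear_combination -hu
  have h3 : ((Real.cos t : ℂ) - w) * (2 * z * u) = (z - u) * (z * u - 1) := by
    rw [hcos, hw]
    field_simp
    linear_combination u * hz1
  have h4 : z * u - 1 = z * (starRingEnd ℂ) ((starRingEnd ℂ) u - z) := by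
    rw [map_sub, Complex.conj_conj]
    linear_combination hz1
  have h5 := congrArg Complex.normSq h3
  rw [h4] at h5
  simp only [map_mul, Complex.normSq_conj, hzn, Complex.normSq_ofReal] at h5 ⊢
  have h6 : Complex.normSq ((starRingEnd ℂ) u - z) = Complex.normSq (z - (starRingEnd ℂ) u) := by
    rw [← Complex.normSq_neg, neg_sub]
  have h7 : Complex.normSq 2 = 4 := by
    rw [show (2 : ℂ) = ((2 : ℝ) : ℂ) by simp, Complex.normSq_ofReal]
    norm_num
  have h8 : (1 / (2 * ‖u‖)) * (1 / (2 * ‖u‖)) = 1 / (4 * Complex.normSq u) := by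
    rw [Complex.normSq_eq_norm_sq]
    field_simp
    norm_num
  rw [h6, h7] at h5
  rw [h8]
  field_simp
  linear_combination h5

/-- For real `w` outside `(-1, 1)` a linear factor suffices. -/
lemma abs_cos_sub_eq {w : ℝ} (hw : 1 ≤ |w|) : ∃ E : ℝ[X], E.natDegree ≤ 1 ∧
    ∀ t : ℝ, |Real.cos t - w| = Complex.normSq (aeval (Complex.exp (t * Complex.I)) E) := by
  obtain ⟨u, hu⟩ : ∃ u : ℝ, u ^ 2 - 2 * w * u + 1 = 0 := by
    have h : 0 ≤ w ^ 2 - 1 := by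
      have := one_le_sq_iff_one_le_abs w |>.2 hw
      linarith
    exact ⟨w + √(w ^ 2 - 1), by linear_combination Real.sq_sqrt h⟩
  have hu0 : u ≠ 0 := by
    rintro rfl
    simp at hu
  have hua := abs_pos.2 hu0
  refine ⟨C (1 / √(2 * |u|)) * (X - C u), ?_, fun t => ?_⟩
  · compute_degree
  have hs : √(2 * |u|) * √(2 * |u|) = 2 * |u| := Real.mul_self_sqrt (by positivity)
  have h1 : Complex.normSq (Complex.exp (t * Complex.I) - u) = 1 - 2 * u * Real.cos t + u ^ 2 := by
    rw [Complex.normSq_apply, Complex.exp_mul_I]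
    simp [Complex.cos_ofReal_re, Complex.sin_ofReal_re]
    linear_combination Real.sin_sq_add_cos_sq t
  have h2 : 1 - 2 * u * Real.cos t + u ^ 2 = 2 * u * (w - Real.cos t) := by
    linear_combination hu
  have h3 : |2 * u * (w - Real.cos t)| = 2 * u * (w - Real.cos t) :=
    abs_of_nonneg (by rw [← h2, ← h1]; exact Complex.normSq_nonneg _)
  simp only [map_mul, map_sub, aeval_X, aeval_C, Complex.coe_algebraMap, Complex.normSq_ofReal]
  rw [h1, h2, ← h3, abs_mul, abs_mul, abs_two, abs_sub_comm w, div_mul_div_comm, hs]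
  field_simp

/-- A real polynomial nonnegative on `[-1, 1]` off one point is nonnegative there too. -/
lemma eval_nonneg_of_ne {P : ℝ[X]} {w : ℝ} (h : ∀ x ∈ Set.Icc (-1 : ℝ) 1, x ≠ w → 0 ≤ P.eval x) :
    ∀ x ∈ Set.Icc (-1 : ℝ) 1, 0 ≤ P.eval x := by
  have hcl : Set.Icc (-1 : ℝ) 1 ⊆ closure (Set.Ioo (-1) 1 \ {w}) := by
    rw [← closure_Ioo (by norm_num : (-1 : ℝ) ≠ 1)]
    exact closure_minimal ((dense_compl_singleton w).open_subset_closure_inter isOpen_Ioo)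
      isClosed_closure
  have hclosed : IsClosed {x | 0 ≤ P.eval x} := isClosed_le continuous_const P.continuous
  intro x hx
  exact closure_minimal (fun y hy => h y (Set.Ioo_subset_Icc_self hy.1) hy.2) hclosed (hcl hx)

/-- **Fejér–Riesz** for cosine polynomials: a real polynomial nonnegative on `[-1, 1]` is,
at `cos t`, the squared modulus at `exp (t * I)` of a real polynomial of no larger degree. -/
theorem exists_eval_cos_eq_normSq (P : ℝ[X]) (hP : ∀ x ∈ Set.Icc (-1 : ℝ) 1, 0 ≤ P.eval x) :
    ∃ D : ℝ[X], D.natDegree ≤ P.natDegree ∧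
      ∀ t : ℝ, P.eval (Real.cos t) = Complex.normSq (aeval (Complex.exp (t * Complex.I)) D) := by
  induction hn : P.natDegree using Nat.strong_induction_on generalizing P with
  | _ n ih =>
  have hcosmem : ∀ t, Real.cos t ∈ Set.Icc (-1 : ℝ) 1 := Real.cos_mem_Icc
  by_cases hdeg : P.natDegree = 0
  · rw [natDegree_eq_zero] at hdeg
    obtain ⟨c, rfl⟩ := hdeg
    have hc : 0 ≤ c := by simpa using hP 0 (by simp)
    refine ⟨C √c, by simp, fun t => ?_⟩
    simp [Complex.normSq_ofReal, Real.mul_self_sqrt hc]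
  have hP0 : P ≠ 0 := by
    rintro rfl
    simp at hdeg
  -- The inductive step, given a factor with its own representation.
  have step : ∀ (k : ℕ) (Q R E : ℝ[X]), 0 < k → P = Q * R → Q.natDegree = k →
      E.natDegree ≤ k →
      (∀ t : ℝ, Q.eval (Real.cos t) = Complex.normSq (aeval (Complex.exp (t * Complex.I)) E)) →
      (∀ x ∈ Set.Icc (-1 : ℝ) 1, 0 ≤ R.eval x) →
      ∃ D : ℝ[X], D.natDegree ≤ n ∧
      ∀ t : ℝ, P.eval (Real.cos t) =
        Complex.normSq (aeval (Complex.exp (t * Complex.I)) D) := by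
    intro k Q R E hk hPQ hQ hE hQE hR
    have hQR : Q ≠ 0 ∧ R ≠ 0 := mul_ne_zero_iff.1 (hPQ ▸ hP0)
    have hdegs : n = k + R.natDegree := by
      rw [← hn, hPQ, natDegree_mul hQR.1 hQR.2, hQ]
    obtain ⟨D, hD, hDt⟩ := ih R.natDegree (by omega) R hR rfl
    refine ⟨E * D, natDegree_mul_le.trans (by omega), fun t => ?_⟩
    rw [hPQ, eval_mul, hQE, hDt, map_mul, map_mul]
  obtain ⟨w, hw⟩ : ∃ w : ℂ, aeval w P = 0 :=
    IsAlgClosed.exists_aeval_eq_zero ℂ P (by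
      rw [degree_eq_natDegree hP0]
      exact_mod_cast hdeg)
  by_cases him : w.im = 0
  · obtain ⟨r, rfl⟩ : ∃ r : ℝ, (r : ℂ) = w := ⟨w.re, by apply Complex.ext <;> simp [him]⟩
    have hr : P.IsRoot r := by
      rw [← Complex.coe_algebraMap, aeval_algebraMap_apply] at hw
      simpa using hw
    obtain ⟨R, hR⟩ := dvd_iff_isRoot.2 hr
    by_cases hr1 : 1 ≤ |r|
    · obtain ⟨E, hE, hEt⟩ := abs_cos_sub_eq hr1
      rcases le_abs.1 hr1 with h | h
      -- Signs are chosen so that the linear factor is nonnegative on `[-1, 1]`; it may vanish at an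
      -- endpoint, where the sign of the cofactor follows by continuity.
      · refine step 1 (C r - X) (-R) E one_pos (by rw [hR]; ring) ?_ hE (fun t => ?_) ?_
        · rw [← neg_sub, natDegree_neg, natDegree_X_sub_C]
        · rw [← hEt, abs_of_nonpos (by linarith [(hcosmem t).2])]
          simp
        · refine eval_nonneg_of_ne (w := r) fun x hx hxr => ?_
          have := hP x hx
          rw [hR, eval_mul, eval_sub, eval_X, eval_C] at this
          have hlt : x - r < 0 := by
            have := lt_of_le_of_ne (hx.2.trans h) hxr
            linarith
          rw [eval_neg, neg_nonneg]
          exact nonpos_of_mul_nonneg_right this hlt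
      · refine step 1 (X - C r) R E one_pos hR (natDegree_X_sub_C r) hE (fun t => ?_) ?_
        · rw [← hEt, abs_of_nonneg (by linarith [(hcosmem t).1])]
          simp
        · refine eval_nonneg_of_ne (w := r) fun x hx hxr => ?_
          have := hP x hx
          rw [hR, eval_mul, eval_sub, eval_X, eval_C] at this
          have hlt : 0 < x - r := by
            have := lt_of_le_of_ne (show r ≤ x by linarith [hx.1]) (Ne.symm hxr)
            linarith
          exact nonneg_of_mul_nonneg_right this hlt
    · obtain ⟨E, hE, hEt⟩ := normSq_cos_sub_eq r
      have hrI : r ∈ Set.Ioo (-1 : ℝ) 1 := abs_lt.1 (not_le.1 hr1)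
      -- At an interior root `P` cannot change sign, so the cofactor changes sign or vanishes there;
      -- either way `r` is a double root of `P`.
      have hRr : R.IsRoot r := by
        apply le_antisymm
        · have hsub : Set.Ioo (-1) r ⊆ {x | R.eval x ≤ 0} := fun x hx => by
            have := hP x ⟨hx.1.le, (hx.2.trans hrI.2).le⟩
            rw [hR, eval_mul, eval_sub, eval_X, eval_C] at this
            exact nonpos_of_mul_nonneg_right this (sub_neg.2 hx.2)
          have hcl := closure_minimal hsub (isClosed_le R.continuous continuous_const)
          rw [closure_Ioo hrI.1.ne] at hcl
          exact hcl ⟨hrI.1.le, le_rfl⟩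
        · have hsub : Set.Ioo r 1 ⊆ {x | 0 ≤ R.eval x} := fun x hx => by
            have := hP x ⟨(hrI.1.trans hx.1).le, hx.2.le⟩
            rw [hR, eval_mul, eval_sub, eval_X, eval_C] at this
            exact nonneg_of_mul_nonneg_right this (sub_pos.2 hx.1)
          have hcl := closure_minimal hsub (isClosed_le continuous_const R.continuous)
          rw [closure_Ioo hrI.2.ne] at hcl
          exact hcl ⟨le_rfl, hrI.2.le⟩
      obtain ⟨R', hR'⟩ := dvd_iff_isRoot.2 hRr
      refine step 2 ((X - C r) ^ 2) R' E two_pos (by rw [hR, hR']; ring) (by simp) hE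
        (fun t => ?_) ?_
      · rw [← hEt, ← Complex.ofReal_sub, Complex.normSq_ofReal]
        simp [sq]
      · refine eval_nonneg_of_ne (w := r) fun x hx hxr => ?_
        have := hP x hx
        rw [hR, hR', ← mul_assoc, ← sq, eval_mul, eval_pow, eval_sub, eval_X, eval_C] at this
        exact nonneg_of_mul_nonneg_right this (by
          have := sub_ne_zero.2 hxr
          positivity)
  · obtain ⟨R, hR⟩ := P.quadratic_dvd_of_aeval_eq_zero_im_ne_zero hw him
    obtain ⟨E, hE, hEt⟩ := normSq_cos_sub_eq w
    have heval : ∀ x : ℝ, (X ^ 2 - C (2 * w.re) * X + C (‖w‖ ^ 2)).eval x =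
        Complex.normSq ((x : ℂ) - w) := by
      intro x
      rw [← Complex.normSq_eq_norm_sq, Complex.normSq_apply, Complex.normSq_apply]
      simp
      ring
    refine step 2 _ R E two_pos hR (by compute_degree!) hE (fun t => ?_) fun x hx => ?_
    · rw [heval, hEt]
    · have := hP x hx
      rw [hR, eval_mul, heval] at this
      refine nonneg_of_mul_nonneg_right this (Complex.normSq_pos.2 fun h => him ?_)
      simpa using congrArg Complex.im h

/-! ### From vectors to sine polynomials -/

lemma im_exp_pow (t : ℝ) (n : ℕ) :
    (Complex.exp (t * Complex.I) ^ n).im = Real.sin (n * t) := by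
  rw [← Complex.exp_nat_mul, ← mul_assoc, ← Complex.ofReal_natCast, ← Complex.ofReal_mul,
    Complex.exp_ofReal_mul_I_im]

lemma re_exp_pow (t : ℝ) (n : ℕ) :
    (Complex.exp (t * Complex.I) ^ n).re = Real.cos (n * t) := by
  rw [← Complex.exp_nat_mul, ← mul_assoc, ← Complex.ofReal_natCast, ← Complex.ofReal_mul,
    Complex.exp_ofReal_mul_I_re]

lemma sum_coeff_mul_sin_eq_im {N : ℕ} {p : ℝ[X]} (hp : p.natDegree ≤ N) (t : ℝ) :
    ∑ j ∈ Finset.Icc 1 N, p.coeff j * Real.sin ((j : ℝ) * t) =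
      (aeval (Complex.exp (t * Complex.I)) p).im := by
  rw [aeval_eq_sum_range' (Nat.lt_succ_of_le hp), Complex.im_sum, Finset.range_eq_Ico,
    Finset.sum_eq_sum_Ico_succ_bot (Nat.succ_pos N)]
  simp only [Complex.smul_im, im_exp_pow, smul_eq_mul]
  simp only [Nat.cast_zero, zero_mul, Real.sin_zero, mul_zero, zero_add]
  rfl

lemma coeffSum_eq_eval_one {N : ℕ} {p : ℝ[X]} (hp : p.natDegree ≤ N) (h0 : p.coeff 0 = 0) :
    coeffSum N p = p.eval 1 := by
  rw [eval_eq_sum_range' (Nat.lt_succ_of_le hp), Finset.range_eq_Ico,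
    Finset.sum_eq_sum_Ico_succ_bot (Nat.succ_pos N)]
  simp only [h0, one_pow, mul_one, zero_add]
  rfl

/-- The polynomial whose sine polynomial is `sin t * cos (m * t)`. -/
noncomputable def sinCosPoly : ℕ → ℝ[X]
  | 0 => X
  | 1 => C (1 / 2) * X ^ 2
  | m + 2 => C (1 / 2) * (X ^ (m + 3) - X ^ (m + 1))

lemma natDegree_sinCosPoly_le (m : ℕ) : (sinCosPoly m).natDegree ≤ m + 1 := by
  match m with
  | 0 => exact natDegree_X_le
  | 1 => exact (natDegree_C_mul_X_pow_le _ _)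
  | m + 2 =>
    refine (natDegree_C_mul_le _ _).trans ((natDegree_sub_le _ _).trans ?_)
    simp

lemma coeff_zero_sinCosPoly (m : ℕ) : (sinCosPoly m).coeff 0 = 0 := by
  match m with
  | 0 => simp [sinCosPoly]
  | 1 => simp [sinCosPoly]
  | m + 2 => simp [sinCosPoly]

/-- From `sin t * cos (m t) = (sin ((m + 1) t) - sin ((m - 1) t)) / 2`, the term `sin t` arises only
for `m = 0` and `m = 2`. This is the origin of `I - B`. -/
lemma coeff_one_sinCosPoly (m : ℕ) :
    (sinCosPoly m).coeff 1 = if m = 0 then 1 else if m = 2 then -1 / 2 else 0 := by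
  match m with
  | 0 => simp [sinCosPoly]
  | 1 => simp [sinCosPoly, coeff_X_pow]
  | 2 =>
    simp [sinCosPoly, coeff_X_pow, coeff_X]
    norm_num
  | m + 3 => simp [sinCosPoly, coeff_X_pow]

/-- For `m ≥ 2` the two monomials cancel at `1`. The surviving cases are the origin of `I + A`. -/
lemma eval_one_sinCosPoly (m : ℕ) :
    (sinCosPoly m).eval 1 = if m = 0 then 1 else if m = 1 then 1 / 2 else 0 := by
  match m with
  | 0 => simp [sinCosPoly]
  | 1 => simp [sinCosPoly]
  | m + 2 => simp [sinCosPoly]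

lemma im_aeval_sinCosPoly (m : ℕ) (t : ℝ) :
    (aeval (Complex.exp (t * Complex.I)) (sinCosPoly m)).im = Real.sin t * Real.cos (m * t) := by
  match m with
  | 0 =>
    simp only [sinCosPoly, aeval_X]
    simp
  | 1 =>
    simp only [sinCosPoly, map_mul, aeval_C, Complex.coe_algebraMap, map_pow, aeval_X,
      Complex.im_ofReal_mul, im_exp_pow]
    push_cast
    rw [Real.sin_two_mul, one_mul]
    ring
  | m + 2 =>
    simp only [sinCosPoly, map_mul, aeval_C, Complex.coe_algebraMap, map_pow, aeval_X, map_sub,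
      Complex.im_ofReal_mul, Complex.sub_im, im_exp_pow]
    push_cast
    have h1 : ((m : ℝ) + 3) * t = (m + 2) * t + t := by ring
    have h2 : ((m : ℝ) + 1) * t = (m + 2) * t - t := by ring
    rw [h1, h2, Real.sin_add, Real.sin_sub]
    ring

/-- The polynomial whose sine polynomial is `sin t * |∑ d_k exp (i k t)|²`. -/
noncomputable def fejerPoly {N : ℕ} (d : Fin N → ℝ) : ℝ[X] :=
  ∑ i, ∑ j, C (d i * d j) * sinCosPoly (Nat.dist i j)

lemma natDegree_fejerPoly_le {N : ℕ} (d : Fin N → ℝ) : (fejerPoly d).natDegree ≤ N := by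
  refine natDegree_sum_le_of_forall_le _ _ fun i _ => natDegree_sum_le_of_forall_le _ _ fun j _ =>
    (natDegree_C_mul_le _ _).trans ((natDegree_sinCosPoly_le _).trans ?_)
  have := i.2
  have := j.2
  unfold Nat.dist
  omega

lemma coeff_zero_fejerPoly {N : ℕ} (d : Fin N → ℝ) : (fejerPoly d).coeff 0 = 0 := by
  simp only [fejerPoly, finsetSum_coeff, coeff_C_mul, coeff_zero_sinCosPoly, mul_zero,
    Finset.sum_const_zero]

lemma coeff_one_fejerPoly {N : ℕ} (d : Fin N → ℝ) :
    (fejerPoly d).coeff 1 = d ⬝ᵥ (1 - matB N) *ᵥ d := by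
  simp only [fejerPoly, finsetSum_coeff, coeff_C_mul, coeff_one_sinCosPoly, dotProduct, mulVec,
    Finset.mul_sum]
  refine Finset.sum_congr rfl fun i _ => Finset.sum_congr rfl fun j _ => ?_
  have h0 : Nat.dist i j = 0 ↔ i = j := by
    rw [Fin.ext_iff, Nat.dist]
    omega
  have h1 : Nat.dist i j = 2 ↔ (i : ℕ) + 2 = j ∨ (j : ℕ) + 2 = i := by
    rw [Nat.dist]
    omega
  simp only [Matrix.sub_apply, one_apply, matB, of_apply, h0, h1]
  by_cases hij : i = j
  · subst hij
    simp
  · by_cases hij' : (i : ℕ) + 2 = j ∨ (j : ℕ) + 2 = i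
    · simp only [hij, hij', if_true, if_false]
      ring
    · simp only [hij, hij', if_false]
      ring

lemma coeffSum_fejerPoly {N : ℕ} (d : Fin N → ℝ) :
    coeffSum N (fejerPoly d) = d ⬝ᵥ (1 + matA N) *ᵥ d := by
  rw [coeffSum_eq_eval_one (natDegree_fejerPoly_le d) (coeff_zero_fejerPoly d)]
  simp only [fejerPoly, eval_finsetSum, eval_mul, eval_C, eval_one_sinCosPoly, dotProduct, mulVec,
    Finset.mul_sum]
  refine Finset.sum_congr rfl fun i _ => Finset.sum_congr rfl fun j _ => ?_
  have h0 : Nat.dist i j = 0 ↔ i = j := by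
    rw [Fin.ext_iff, Nat.dist]
    omega
  have h1 : Nat.dist i j = 1 ↔ (i : ℕ) + 1 = j ∨ (j : ℕ) + 1 = i := by
    rw [Nat.dist]
    omega
  simp only [Matrix.add_apply, one_apply, matA, of_apply, h0, h1]
  by_cases hij : i = j
  · subst hij
    simp
  · by_cases hij' : (i : ℕ) + 1 = j ∨ (j : ℕ) + 1 = i
    · simp only [hij, hij', if_true, if_false]
      ring
    · simp only [hij, hij', if_false]
      ring

lemma cos_dist_mul (i j : ℕ) (t : ℝ) :
    Real.cos ((Nat.dist i j : ℕ) * t) =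
      Real.cos (i * t) * Real.cos (j * t) + Real.sin (i * t) * Real.sin (j * t) := by
  rw [← Real.cos_sub]
  rcases le_total i j with h | h
  · rw [Nat.dist_eq_sub_of_le h, Nat.cast_sub h, ← Real.cos_neg]
    ring_nf
  · rw [Nat.dist_eq_sub_of_le_right h, Nat.cast_sub h]
    ring_nf

lemma sum_coeff_fejerPoly_mul_sin {N : ℕ} (d : Fin N → ℝ) (t : ℝ) :
    ∑ j ∈ Finset.Icc 1 N, (fejerPoly d).coeff j * Real.sin ((j : ℝ) * t) =
      Real.sin t * Complex.normSq (∑ k : Fin N, d k • Complex.exp (t * Complex.I) ^ (k : ℕ)) := by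
  rw [sum_coeff_mul_sin_eq_im (natDegree_fejerPoly_le d), Complex.normSq_apply]
  simp only [Complex.re_sum, Complex.im_sum, Complex.smul_re, Complex.smul_im, re_exp_pow,
    im_exp_pow, smul_eq_mul, fejerPoly, map_sum, map_mul, aeval_C, Complex.coe_algebraMap]
  simp only [← Complex.ofReal_mul, Complex.im_ofReal_mul, im_aeval_sinCosPoly, cos_dist_mul]
  simp only [Finset.sum_mul_sum, ← Finset.sum_add_distrib]
  simp only [Finset.mul_sum]
  refine Finset.sum_congr rfl fun i _ => Finset.sum_congr rfl fun j _ => ?_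
  ring

lemma fejerPoly_mem_admissible {N : ℕ} {d : Fin N → ℝ} (hd : d ⬝ᵥ (1 - matB N) *ᵥ d = 1) :
    fejerPoly d ∈ admissible N := by
  refine ⟨natDegree_fejerPoly_le d, coeff_zero_fejerPoly d, by rw [coeff_one_fejerPoly, hd],
    fun t ht => ?_⟩
  rw [sum_coeff_fejerPoly_mul_sin]
  exact mul_nonneg (Real.sin_nonneg_of_mem_Icc ht) (Complex.normSq_nonneg _)

lemma fejerPoly_smul {N : ℕ} (c : ℝ) (d : Fin N → ℝ) :
    fejerPoly (c • d) = C (c ^ 2) * fejerPoly d := by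
  simp only [fejerPoly, Finset.mul_sum]
  refine Finset.sum_congr rfl fun i _ => Finset.sum_congr rfl fun j _ => ?_
  rw [← mul_assoc, ← C_mul]
  congr 2
  simp only [Pi.smul_apply, smul_eq_mul]
  ring

/-! ### From sine polynomials back to vectors -/

/-- The polynomial in `cos t` obtained by dividing the sine polynomial of `p` by `sin t`. -/
noncomputable def cosQuotient (N : ℕ) (p : ℝ[X]) : ℝ[X] :=
  ∑ k ∈ Finset.range N, C (p.coeff (k + 1)) * Chebyshev.U ℝ k

lemma natDegree_cosQuotient_lt {N : ℕ} (hN : 1 ≤ N) (p : ℝ[X]) :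
    (cosQuotient N p).natDegree < N := by
  refine Nat.lt_of_le_pred hN (natDegree_sum_le_of_forall_le _ _ fun k hk =>
    (natDegree_C_mul_le _ _).trans ?_)
  rw [Chebyshev.natDegree_U_natCast]
  exact Nat.le_pred_of_lt (Finset.mem_range.1 hk)

/-- Rests on `U_k(cos t) sin t = sin ((k + 1) t)`, whence the index shift. -/
lemma eval_cosQuotient_mul_sin (N : ℕ) (p : ℝ[X]) (t : ℝ) :
    (cosQuotient N p).eval (Real.cos t) * Real.sin t =
      ∑ j ∈ Finset.Icc 1 N, p.coeff j * Real.sin ((j : ℝ) * t) := by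
  have : Finset.Icc 1 N = Finset.Ico 1 (N + 1) := rfl
  rw [this, Finset.sum_Ico_eq_sum_range, cosQuotient, eval_finsetSum, Finset.sum_mul]
  refine Finset.sum_congr (by simp) fun k _ => ?_
  rw [eval_mul, eval_C, mul_assoc, Chebyshev.U_real_cos, add_comm 1 k]
  push_cast
  rfl

/-- A sine polynomial determines its coefficients. -/
lemma eq_of_sum_coeff_mul_sin_eq {N : ℕ} {p q : ℝ[X]} (hp : p.natDegree ≤ N)
    (hq : q.natDegree ≤ N) (h0 : p.coeff 0 = q.coeff 0)
    (h : ∀ t : ℝ, ∑ j ∈ Finset.Icc 1 N, p.coeff j * Real.sin ((j : ℝ) * t) =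
      ∑ j ∈ Finset.Icc 1 N, q.coeff j * Real.sin ((j : ℝ) * t)) : p = q := by
  have hPQ : cosQuotient N p = cosQuotient N q := by
    refine eq_of_infinite_eval_eq _ _ ((Set.Ioo_infinite (show (-1 : ℝ) < 1 by norm_num)).mono ?_)
    intro x hx
    have hs : Real.sin (Real.arccos x) ≠ 0 := by
      rw [Real.sin_arccos]
      have : 0 < 1 - x ^ 2 := by nlinarith [hx.1, hx.2]
      exact (Real.sqrt_pos.2 this).ne'
    have := h (Real.arccos x)
    rw [← eval_cosQuotient_mul_sin, ← eval_cosQuotient_mul_sin,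
      Real.cos_arccos hx.1.le hx.2.le] at this
    exact mul_right_cancel₀ hs this
  -- The `U_k` have degree `k`, so they are linearly independent and their coefficients can be
  -- compared.
  let U : Polynomial.Sequence ℝ := ⟨fun n => Chebyshev.U ℝ n, Chebyshev.degree_U_natCast ℝ⟩
  have hli := linearIndependent_iff'.1 U.linearIndependent (Finset.range N)
    (fun k => p.coeff (k + 1) - q.coeff (k + 1)) (by
      simp only [sub_smul, Finset.sum_sub_distrib, smul_eq_C_mul]
      exact sub_eq_zero.2 hPQ)
  ext n
  rcases n with _ | n
  · exact h0
  · by_cases hn : n < N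
    · exact sub_eq_zero.1 (hli n (Finset.mem_range.2 hn))
    · rw [coeff_eq_zero_of_natDegree_lt (by omega), coeff_eq_zero_of_natDegree_lt (by omega)]

/-- Division by `sin t > 0` covers the open interval; the endpoints, where `sin t = 0`, follow by
continuity. -/
lemma cosQuotient_eval_nonneg {N : ℕ} {p : ℝ[X]} (hp : p ∈ admissible N) :
    ∀ x ∈ Set.Icc (-1 : ℝ) 1, 0 ≤ (cosQuotient N p).eval x := by
  have hsub : Set.Ioo (-1 : ℝ) 1 ⊆ {x | 0 ≤ (cosQuotient N p).eval x} := fun x hx => by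
    have hs : 0 < Real.sin (Real.arccos x) := by
      rw [Real.sin_arccos]
      exact Real.sqrt_pos.2 (by nlinarith [hx.1, hx.2])
    have := hp.2.2.2 (Real.arccos x) ⟨Real.arccos_nonneg x, Real.arccos_le_pi x⟩
    rw [← eval_cosQuotient_mul_sin, Real.cos_arccos hx.1.le hx.2.le] at this
    exact nonneg_of_mul_nonneg_left this hs
  have hcl := closure_minimal hsub (isClosed_le continuous_const (cosQuotient N p).continuous)
  rwa [closure_Ioo (by norm_num)] at hcl

/-- Every admissible polynomial comes from a vector. -/
lemma exists_eq_fejerPoly {N : ℕ} (hN : 1 ≤ N) {p : ℝ[X]} (hp : p ∈ admissible N) :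
    ∃ d : Fin N → ℝ, p = fejerPoly d := by
  obtain ⟨D, hD, hDt⟩ := exists_eval_cos_eq_normSq (cosQuotient N p) (cosQuotient_eval_nonneg hp)
  refine ⟨fun k => D.coeff k, eq_of_sum_coeff_mul_sin_eq hp.1 (natDegree_fejerPoly_le _)
    (by rw [hp.2.1, coeff_zero_fejerPoly]) fun t => ?_⟩
  rw [sum_coeff_fejerPoly_mul_sin, ← eval_cosQuotient_mul_sin, hDt,
    aeval_eq_sum_range' (hD.trans_lt (natDegree_cosQuotient_lt hN p)), Finset.sum_range, mul_comm]

/-! ### Existence, uniqueness and simplicity -/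

theorem corollary4p1p1 (N : ℕ) (hN : 1 ≤ N) :
    (∃! p : ℝ[X], IsExtremal N p) ∧
      ∃ l : ℝ, IsGreatest {x : ℝ | (pencilDet N).IsRoot x} l ∧
        (pencilDet N).rootMultiplicity l = 1 := by
  have : Nonempty (Fin N) := ⟨⟨0, hN⟩⟩
  have hK := posDef_one_sub_matB N
  have hM : (1 + matA N).IsHermitian := isHermitian_one.add (isHermitian_matA N)
  obtain ⟨l, hneg, ⟨v, hv0, hv⟩, hl, hsimple⟩ := exists_isGreatest_pencil hM hK
  have hker : ∀ w, (1 + matA N - l • (1 - matB N)) *ᵥ w = 0 → w ⟨0, hN⟩ = 0 → w = 0 :=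
    fun w => pencil_kernel_eq_zero hN hneg
  refine ⟨?_, l, hl, hsimple ⟨_, hker⟩⟩
  have hform : ∀ w, w ⬝ᵥ (1 + matA N - l • (1 - matB N)) *ᵥ w =
      w ⬝ᵥ (1 + matA N) *ᵥ w - l * (w ⬝ᵥ (1 - matB N) *ᵥ w) := by
    intro w
    rw [sub_mulVec, dotProduct_sub, smul_mulVec, dotProduct_smul, smul_eq_mul]
  have hspan : ∀ w, (1 + matA N - l • (1 - matB N)) *ᵥ w = 0 → ∃ c : ℝ, w = c • v := by
    intro w hw
    have hvk : v ⟨0, hN⟩ ≠ 0 := fun h => hv0 (hker v hv h)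
    refine ⟨w ⟨0, hN⟩ / v ⟨0, hN⟩, sub_eq_zero.1 (hker _ ?_ ?_)⟩
    · rw [mulVec_sub, mulVec_smul, hw, hv, smul_zero, sub_zero]
    · simp [hvk]
  have hle : ∀ p ∈ admissible N, coeffSum N p ≤ l := by
    intro p hp
    obtain ⟨d, rfl⟩ := exists_eq_fejerPoly hN hp
    have h1 := hp.2.2.1
    rw [coeff_one_fejerPoly] at h1
    have h2 := hneg d
    rw [hform, h1] at h2
    rw [coeffSum_fejerPoly]
    linarith
  have hvK : 0 < v ⬝ᵥ (1 - matB N) *ᵥ v := by simpa using hK.dotProduct_mulVec_pos hv0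
  obtain ⟨u, hu, hu1⟩ : ∃ u, (1 + matA N - l • (1 - matB N)) *ᵥ u = 0 ∧
      u ⬝ᵥ (1 - matB N) *ᵥ u = 1 := by
    refine ⟨(√(v ⬝ᵥ (1 - matB N) *ᵥ v))⁻¹ • v, by rw [mulVec_smul, hv, smul_zero], ?_⟩
    rw [mulVec_smul, dotProduct_smul, smul_dotProduct, smul_eq_mul, smul_eq_mul, ← mul_assoc,
      ← mul_inv, Real.mul_self_sqrt hvK.le, inv_mul_cancel₀ hvK.ne']
  have hul : coeffSum N (fejerPoly u) = l := by
    have := hform u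
    rw [hu, hu1, dotProduct_zero] at this
    rw [coeffSum_fejerPoly]
    linarith
  have hadm := fejerPoly_mem_admissible hu1
  refine ⟨fejerPoly u, ⟨hadm, fun p hp => (hle p hp).trans hul.ge⟩, ?_⟩
  rintro p ⟨hp, hmax⟩
  have hpl : coeffSum N p = l := le_antisymm (hle p hp) (hul.ge.trans (hmax hadm))
  obtain ⟨d, rfl⟩ := exists_eq_fejerPoly hN hp
  have h1 := hp.2.2.1
  rw [coeffSum_fejerPoly] at hpl
  rw [coeff_one_fejerPoly] at h1
  have hS : (1 + matA N - l • (1 - matB N)).IsHermitian :=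
    hM.sub (by simpa [IsHermitian] using congrArg (l • ·) hK.isHermitian.eq)
  -- An extremal `d` makes the semidefinite form vanish, hence lies in its kernel.
  have hd := mulVec_eq_zero_of_nonpos hS hneg (v := d) (by rw [hform, hpl, h1]; ring)
  obtain ⟨a, rfl⟩ := hspan d hd
  obtain ⟨b, rfl⟩ := hspan u hu
  rw [mulVec_smul, dotProduct_smul, smul_dotProduct, smul_eq_mul, smul_eq_mul] at h1 hu1
  rw [fejerPoly_smul, fejerPoly_smul]
  congr 2
  -- Normalization fixes the multiple of `v` only up to sign, but `fejerPoly` sees only its square.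
  have : (a ^ 2 - b ^ 2) * (v ⬝ᵥ (1 - matB N) *ᵥ v) = 0 := by linear_combination h1 - hu1
  exact sub_eq_zero.1 ((mul_eq_zero.1 this).resolve_right hvK.ne')
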